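/- Let $\mathcal{A}$ be a weakly idempotent complete exact category (in the sense of Quillen) with enough projectives and enough injectives. Conventions. For a class $\mathcal{X}$ of objects, $\mathcal{X}^{\perp}=\{M : \mathrm{Ext}^1_{\mathcal{A}}(X,M)=0 \text{ for all } X\in\mathcal{X}\}$, and ${}^{\perp}\mathcal{X}$ is defined dually. A pair $(\mathcal{X},\mathcal{Y})$ of classes of objects is a cotorsion pair if $\mathcal{X}^{\perp}=\mathcal{Y}$ and ${}^{\perp}\mathcal{Y}=\mathcal{X}$. It is complete if for every object $M$ there are conflations $Y\rightarrowtail X\twoheadrightarrow M$ and $M\rightarrowtail Y'\twoheadrightarrow X'$ with $X,X'\in\mathcal{X}$ and $Y,Y'\in\mathcal{Y}$. It is hereditary if $\mathcal{X}$ is closed under kernels of deflations and $\mathcal{Y}$ is closed under cokernels of inflations. A hereditary Hovey triple is a triple $(\mathcal{C},\mathcal{W},\mathcal{F})$ of classes of objects such that $(\mathcal{C}\cap\mathcal{W},\mathcal{F})$ and $(\mathcal{C},\mathcal{W}\cap\mathcal{F})$ are complete hereditary cotorsion pairs and $\mathcal{W}$ is thick, that is, closed under direct summands and such that whenever two of the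 three objects in a conflation lie in $\mathcal{W}$, so does the third. For a class $\mathcal{X}$ of objects and an integer $n\ge 0$, the $\mathcal{X}$-projective dimension of an object $M$ is the infimum of the integers $m\ge 0$ for which there is an acyclic sequence $X_m\rightarrowtail X_{m-1}\to\cdots\to X_0\twoheadrightarrow M$ with all $X_i\in\mathcal{X}$ (and $\infty$ if there is none); dually, the $\mathcal{X}$-injective dimension of $M$ is defined by acyclic sequences $M\rightarrowtail X^0\to\cdots\to X^{m-1}\twoheadrightarrow X^m$ with all $X^i\in\mathcal{X}$. Write $\mathcal{C}_n$ and $(\mathcal{C}\cap\mathcal{W})_n$ for the classes of objects of $\mathcal{C}$-projective, respectively $(\mathcal{C}\cap\mathcal{W})$-projective, dimension at most $n$, and $\mathcal{F}_n$ and $(\mathcal{W}\cap\mathcal{F})_n$ for the classes of objects of $\mathcal{F}$-injective, respectively $(\mathcal{W}\cap\mathcal{F})$-injective, dimension at most $n$. Statement. Let $(\mathcal{C},\mathcal{W},\mathcal{F})$ be a hereditary Hovey triple in $\mathcal{A}$. Then for every integer $n\ge 0$, $$\mathcal{C}_n\cap\mathcal{W}=(\mathcal{C}\cap\mathcal{W})_n\qquad\text{and}\qquad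 \mathcal{W}\cap\mathcal{F}_n=(\mathcal{W}\cap\mathcal{F})_n .$$ -/

import Mathlib

open CategoryTheory CategoryTheory.Limits

universe v u

namespace ExactCat

section Basic

variable {A : Type u} [Category.{v} A] [Preadditive A]

/-- A sequence `X₁ ⟶ X₂ ⟶ X₃` is a kernel-cokernel pair if the first map is a kernel of the
second and the second map is a cokernel of the first. -/
def IsKernelCokernelPair (S : ShortComplex A) : Prop :=
  Nonempty (IsLimit (KernelFork.ofι S.f S.zero)) ∧
    Nonempty (IsColimit (CokernelCofork.ofπ S.g S.zero))

/-- `i` is the first map of some member of the class `P` of short sequences. -/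
def IsFirstMap (P : ObjectProperty (ShortComplex A)) {X Y : A} (i : X ⟶ Y) : Prop :=
  ∃ (Z : A) (p : Y ⟶ Z) (w : i ≫ p = 0), P (ShortComplex.mk i p w)

/-- `p` is the second map of some member of the class `P` of short sequences. -/
def IsSecondMap (P : ObjectProperty (ShortComplex A)) {Y Z : A} (p : Y ⟶ Z) : Prop :=
  ∃ (X : A) (i : X ⟶ Y) (w : i ≫ p = 0), P (ShortComplex.mk i p w)

end Basic

/-- An exact structure (in the sense of Quillen, with Bühler's axioms) on a preadditive category:
a class of kernel-cokernel pairs, closed under isomorphism, whose first maps (the inflations)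
contain the identities, are closed under composition and are stable under pushout along
arbitrary morphisms (which are required to exist), and dually for the second maps
(the deflations). -/
structure ExactStructure (A : Type u) [Category.{v} A] [Preadditive A] where
  /-- the class of conflations -/
  conflation : ObjectProperty (ShortComplex A)
  isKernelCokernelPair : ∀ S : ShortComplex A, conflation S → IsKernelCokernelPair S
  of_iso : ∀ S T : ShortComplex A, Nonempty (S ≅ T) → conflation S → conflation T
  inflation_id : ∀ X : A, IsFirstMap conflation (𝟙 X)
  deflation_id : ∀ X : A, IsSecondMap conflation (𝟙 X)
  inflation_comp : ∀ {X Y Z : A} (i : X ⟶ Y) (j : Y ⟶ Z),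
    IsFirstMap conflation i → IsFirstMap conflation j → IsFirstMap conflation (i ≫ j)
  deflation_comp : ∀ {X Y Z : A} (p : X ⟶ Y) (q : Y ⟶ Z),
    IsSecondMap conflation p → IsSecondMap conflation q → IsSecondMap conflation (p ≫ q)
  inflation_pushout : ∀ {X Y X' : A} (i : X ⟶ Y) (f : X ⟶ X'), IsFirstMap conflation i →
    ∃ (Y' : A) (g : Y ⟶ Y') (i' : X' ⟶ Y'), IsPushout i f g i' ∧ IsFirstMap conflation i'
  deflation_pullback : ∀ {Y Z Z' : A} (p : Y ⟶ Z) (f : Z' ⟶ Z), IsSecondMap conflation p →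
    ∃ (Y' : A) (g : Y' ⟶ Y) (p' : Y' ⟶ Z'), IsPullback g p' p f ∧ IsSecondMap conflation p'

/-- Weak idempotent completeness: every split monomorphism has a cokernel. -/
def WeaklyIdempotentComplete (A : Type u) [Category.{v} A] [Preadditive A] : Prop :=
  ∀ {X Y : A} (f : X ⟶ Y), IsSplitMono f → HasCokernel f

namespace ExactStructure

section Exact

variable {A : Type u} [Category.{v} A] [Preadditive A] (E : ExactStructure A)

/-- `X ⟶ Y ⟶ Z` is a conflation. -/
def IsConflation {X Y Z : A} (i : X ⟶ Y) (p : Y ⟶ Z) : Prop :=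
  ∃ w : i ≫ p = 0, E.conflation (ShortComplex.mk i p w)

/-- Inflations: the first maps of conflations. -/
def IsInflation {X Y : A} (i : X ⟶ Y) : Prop := IsFirstMap E.conflation i

/-- Deflations: the second maps of conflations. -/
def IsDeflation {Y Z : A} (p : Y ⟶ Z) : Prop := IsSecondMap E.conflation p

/-- `P` is projective relative to the exact structure: every morphism from `P` to the target
of a deflation lifts along the deflation. -/
def IsProjective (P : A) : Prop :=
  ∀ {Y Z : A} (p : Y ⟶ Z), E.IsDeflation p → ∀ f : P ⟶ Z, ∃ g : P ⟶ Y, g ≫ p = f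

/-- `I` is injective relative to the exact structure: every morphism from the source of an
inflation to `I` extends along the inflation. -/
def IsInjective (I : A) : Prop :=
  ∀ {X Y : A} (i : X ⟶ Y), E.IsInflation i → ∀ f : X ⟶ I, ∃ g : Y ⟶ I, i ≫ g = f

/-- Every object is the target of a deflation from a projective object. -/
def EnoughProjectives : Prop :=
  ∀ M : A, ∃ (P : A) (p : P ⟶ M), E.IsProjective P ∧ E.IsDeflation p

/-- Every object is the source of an inflation to an injective object. -/
def EnoughInjectives : Prop :=
  ∀ M : A, ∃ (I : A) (i : M ⟶ I), E.IsInjective I ∧ E.IsInflation i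

/-- An extension of `X` by `Y`: a conflation `Y ⟶ mid ⟶ X`. -/
structure Extension (X Y : A) where
  /-- the middle term -/
  mid : A
  /-- the inflation -/
  i : Y ⟶ mid
  /-- the deflation -/
  p : mid ⟶ X
  isConflation : E.IsConflation i p

/-- Equivalence of extensions: an isomorphism of the middle terms inducing the identity on
both ends. -/
instance extensionSetoid (X Y : A) : Setoid (E.Extension X Y) where
  r S T := ∃ e : S.mid ≅ T.mid, S.i ≫ e.hom = T.i ∧ e.hom ≫ T.p = S.p
  iseqv :=
    { refl := fun S => ⟨Iso.refl _, by simp, by simp⟩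
      symm := by
        rintro S T ⟨e, h₁, h₂⟩
        exact ⟨e.symm, by simp [← h₁], by simp [← h₂]⟩
      trans := by
        rintro S T U ⟨e, h₁, h₂⟩ ⟨e', h₁', h₂'⟩
        refine ⟨e ≪≫ e', ?_, ?_⟩
        · rw [Iso.trans_hom, ← Category.assoc, h₁, h₁']
        · rw [Iso.trans_hom, Category.assoc, h₂', h₂] }

/-- The Yoneda extension group `Ext¹(X, Y)` (its underlying set): equivalence classes of
conflations `Y ⟶ mid ⟶ X`. -/
def Ext1 (X Y : A) : Type (max u v) := Quotient (E.extensionSetoid X Y)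

/-- `Ext¹(X, Y) = 0`: there is only one class, that of the split extension, which is the zero
element for the Baer sum. -/
def Ext1Vanishes (X Y : A) : Prop := Subsingleton (E.Ext1 X Y)

/-- The right orthogonal class of `P`. -/
def rightPerp (P : ObjectProperty A) : ObjectProperty A :=
  fun M => ∀ X : A, P X → E.Ext1Vanishes X M

/-- The left orthogonal class of `Q`. -/
def leftPerp (Q : ObjectProperty A) : ObjectProperty A :=
  fun M => ∀ Y : A, Q Y → E.Ext1Vanishes M Y

/-- Cotorsion pairs. -/
structure IsCotorsionPair (P Q : ObjectProperty A) : Prop where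
  rightPerp_eq : E.rightPerp P = Q
  leftPerp_eq : E.leftPerp Q = P

/-- Complete cotorsion pairs. -/
structure IsCompleteCotorsionPair (P Q : ObjectProperty A) : Prop extends
    E.IsCotorsionPair P Q where
  exists_left : ∀ M : A, ∃ (Y X : A) (i : Y ⟶ X) (p : X ⟶ M),
    P X ∧ Q Y ∧ E.IsConflation i p
  exists_right : ∀ M : A, ∃ (Y X : A) (i : M ⟶ Y) (p : Y ⟶ X),
    P X ∧ Q Y ∧ E.IsConflation i p

/-- The two closure conditions making a cotorsion pair hereditary: the left class is closed
under kernels of deflations, the right class under cokernels of inflations. -/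
structure IsHereditary (P Q : ObjectProperty A) : Prop where
  kernel_mem : ∀ {X Y Z : A} (i : X ⟶ Y) (p : Y ⟶ Z), E.IsConflation i p → P Y → P Z → P X
  cokernel_mem : ∀ {X Y Z : A} (i : X ⟶ Y) (p : Y ⟶ Z), E.IsConflation i p → Q X → Q Y → Q Z

/-- Acyclicity of a chain complex `⋯ ⟶ X₂ ⟶ X₁ ⟶ X₀ ⟶ 0`: there are objects `Z i` and
conflations `Z (i + 1) ⟶ X (i + 1) ⟶ Z i` through which the differentials factor, and, at the
right end, `Z 0` is all of `X 0`. -/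
def AcyclicChain (K : ChainComplex A ℕ) : Prop :=
  ∃ (Z : ℕ → A) (ι : ∀ i, Z i ⟶ K.X i) (p : ∀ i, K.X (i + 1) ⟶ Z i),
    IsIso (ι 0) ∧
    (∀ i, E.IsConflation (ι (i + 1)) (p i)) ∧
    (∀ i, p i ≫ ι i = K.d (i + 1) i)

/-- Acyclicity of a cochain complex `0 ⟶ X⁰ ⟶ X¹ ⟶ X² ⟶ ⋯`: there are objects `Z i` and
conflations `Z i ⟶ X (i + 1) ⟶ Z (i + 1)` through which the differentials factor, and, at the
left end, `Z 0` is all of `X 0`. -/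
def AcyclicCochain (K : CochainComplex A ℕ) : Prop :=
  ∃ (Z : ℕ → A) (p : ∀ i, K.X i ⟶ Z i) (ι : ∀ i, Z i ⟶ K.X (i + 1)),
    IsIso (p 0) ∧
    (∀ i, E.IsConflation (ι i) (p (i + 1))) ∧
    (∀ i, p i ≫ ι i = K.d i (i + 1))

/-- There is an acyclic sequence `X_n ↣ X_{n-1} ⟶ ⋯ ⟶ X_0 ↠ M` with all `X_i` in `P`.
It is encoded as a chain complex with `M` in degree `0`, `X_i` in degree `i + 1`, and zero
objects in the degrees above `n + 1`. -/
def HasResolution (P : ObjectProperty A) (n : ℕ) (M : A) : Prop :=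
  ∃ K : ChainComplex A ℕ, E.AcyclicChain K ∧ Nonempty (K.X 0 ≅ M) ∧
    (∀ i, i ≤ n → P (K.X (i + 1))) ∧ (∀ i, n < i → IsZero (K.X (i + 1)))

/-- There is an acyclic sequence `M ↣ Y^0 ⟶ ⋯ ⟶ Y^{n-1} ↠ Y^n` with all `Y^i` in `Q`.
It is encoded as a cochain complex with `M` in degree `0`, `Y^i` in degree `i + 1`, and zero
objects in the degrees above `n + 1`. -/
def HasCoresolution (Q : ObjectProperty A) (n : ℕ) (M : A) : Prop :=
  ∃ K : CochainComplex A ℕ, E.AcyclicCochain K ∧ Nonempty (K.X 0 ≅ M) ∧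
    (∀ i, i ≤ n → Q (K.X (i + 1))) ∧ (∀ i, n < i → IsZero (K.X (i + 1)))

/-- The `P`-projective dimension; it is `⊤` if there is no finite resolution. -/
noncomputable def projDim (P : ObjectProperty A) (M : A) : ℕ∞ :=
  sInf {m : ℕ∞ | ∃ n : ℕ, m = n ∧ E.HasResolution P n M}

/-- The `Q`-injective dimension; it is `⊤` if there is no finite coresolution. -/
noncomputable def injDim (Q : ObjectProperty A) (M : A) : ℕ∞ :=
  sInf {m : ℕ∞ | ∃ n : ℕ, m = n ∧ E.HasCoresolution Q n M}

/-- The class of objects of `P`-projective dimension at most `n`. -/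
def projDimLE (P : ObjectProperty A) (n : ℕ) : ObjectProperty A :=
  fun M => E.projDim P M ≤ n

/-- The class of objects of `Q`-injective dimension at most `n`. -/
def injDimLE (Q : ObjectProperty A) (n : ℕ) : ObjectProperty A :=
  fun M => E.injDim Q M ≤ n

end Exact

section Hovey

variable {A : Type u} [Category.{v} A] [Preadditive A] (E : ExactStructure A)

/-- Thick classes: closed under direct summands (`b.pt` is any object presented as a biproduct
of `X` and `Y`), and with the two-out-of-three property for conflations. -/
structure IsThick (W : ObjectProperty A) : Prop where
  summand : ∀ {X Y : A} (b : BinaryBicone X Y), Nonempty b.IsBilimit → W b.pt → W X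
  left_mem : ∀ {X Y Z : A} (i : X ⟶ Y) (p : Y ⟶ Z), E.IsConflation i p → W Y → W Z → W X
  middle_mem : ∀ {X Y Z : A} (i : X ⟶ Y) (p : Y ⟶ Z), E.IsConflation i p → W X → W Z → W Y
  right_mem : ∀ {X Y Z : A} (i : X ⟶ Y) (p : Y ⟶ Z), E.IsConflation i p → W X → W Y → W Z

/-- Hovey triples. -/
structure IsHoveyTriple (C W F : ObjectProperty A) : Prop where
  trivCof_fib : E.IsCompleteCotorsionPair (C ⊓ W) F
  cof_trivFib : E.IsCompleteCotorsionPair C (W ⊓ F)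
  thick : E.IsThick W

/-- Hereditary Hovey triples. -/
structure IsHereditaryHoveyTriple (C W F : ObjectProperty A) : Prop extends
    E.IsHoveyTriple C W F where
  hereditary_trivCof_fib : E.IsHereditary (C ⊓ W) F
  hereditary_cof_trivFib : E.IsHereditary C (W ⊓ F)

end Hovey

end ExactStructure

end ExactCat

/-! An object with a finite resolution by `C ⊓ W` lies in `W`, because `W` is closed under cokernels
of inflations. Conversely, let `M` be in `W` with a `C`-resolution starting with `K ↣ X ↠ M`. Choose
a deflation `Z ↠ M` with `Z` projective and kernel `L`, and form the pullback `D` of `X` and `Z`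
over `M`. It sits in two conflations, `K ↣ D ↠ Z` and `L ↣ D ↠ X`. The first splits, so `D` has a
resolution as short as that of `K` (`ResolutionLength.of_isConflation_projective`). By the second,
so does `L` (`ResolutionLength.kernel`). Projectives lie in `C ⊓ W`, hence `L` is in `W` and
induction applies (`ResolutionLength.inf`). The resolution produced is projective except for its
last term, which is in `C` by construction and in `W` by two-out-of-three.

The injective statement is the same argument in the opposite exact category. -/

namespace ExactCat

namespace ExactStructure

section Exact

open scoped ZeroObject

variable {A : Type u} [Category.{v} A] [Preadditive A] {E : ExactStructure A}

/-! ### Kernels, base change and splittings of conflations. -/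

namespace IsConflation

variable {X Y Z : A} {i : X ⟶ Y} {p : Y ⟶ Z}

lemma comp_eq_zero (h : E.IsConflation i p) : i ≫ p = 0 := h.1

lemma exists_lift (h : E.IsConflation i p) {T : A} (f : T ⟶ Y) (hf : f ≫ p = 0) :
    ∃ l : T ⟶ X, l ≫ i = f := by
  obtain ⟨w, hc⟩ := h
  obtain ⟨hl⟩ := (E.isKernelCokernelPair _ hc).1
  exact ⟨_, (KernelFork.IsLimit.lift' hl f hf).2⟩

lemma exists_desc (h : E.IsConflation i p) {T : A} (f : Y ⟶ T) (hf : i ≫ f = 0) :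
    ∃ l : Z ⟶ T, p ≫ l = f := by
  obtain ⟨w, hc⟩ := h
  obtain ⟨hl⟩ := (E.isKernelCokernelPair _ hc).2
  exact ⟨_, (CokernelCofork.IsColimit.desc' hl f hf).2⟩

lemma mono (h : E.IsConflation i p) : Mono i := by
  obtain ⟨w, hc⟩ := h
  obtain ⟨hl⟩ := (E.isKernelCokernelPair _ hc).1
  exact mono_of_isLimit_fork hl

lemma epi (h : E.IsConflation i p) : Epi p := by
  obtain ⟨w, hc⟩ := h
  obtain ⟨hl⟩ := (E.isKernelCokernelPair _ hc).2
  exact epi_of_isColimit_cofork hl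

lemma isDeflation (h : E.IsConflation i p) : E.IsDeflation p := ⟨X, i, h.1, h.2⟩

lemma of_iso (h : E.IsConflation i p) {X' Y' Z' : A} {i' : X' ⟶ Y'} {p' : Y' ⟶ Z'}
    (e₁ : X ≅ X') (e₂ : Y ≅ Y') (e₃ : Z ≅ Z') (h₁ : e₁.hom ≫ i' = i ≫ e₂.hom)
    (h₂ : e₂.hom ≫ p' = p ≫ e₃.hom) : E.IsConflation i' p' := by
  obtain ⟨w, hc⟩ := h
  have w' : i' ≫ p' = 0 := by
    rw [← cancel_epi e₁.hom, reassoc_of% h₁, h₂, reassoc_of% w, zero_comp, comp_zero]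
  exact ⟨w', E.of_iso _ _ ⟨ShortComplex.isoMk e₁ e₂ e₃ h₁ h₂⟩ hc⟩

lemma of_kernel (h : E.IsConflation i p) {X' : A} (i' : X' ⟶ Y) [Mono i'] (w : i' ≫ p = 0)
    (hl : ∀ {T : A} (f : T ⟶ Y), f ≫ p = 0 → ∃ l : T ⟶ X', l ≫ i' = f) :
    E.IsConflation i' p := by
  have := h.mono
  obtain ⟨a, ha⟩ := h.exists_lift i' w
  obtain ⟨b, hb⟩ := hl i h.comp_eq_zero
  refine h.of_iso ⟨b, a, ?_, ?_⟩ (Iso.refl _) (Iso.refl _) (by simpa using hb) (by simp)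
  · rw [← cancel_mono i, Category.assoc, ha, hb, Category.id_comp]
  · rw [← cancel_mono i', Category.assoc, hb, ha, Category.id_comp]

/-- The kernel of a deflation is also the kernel of its base changes. -/
lemma of_isPullback (h : E.IsConflation i p) {Y' Z' : A} {g : Y' ⟶ Y} {p' : Y' ⟶ Z'}
    {f : Z' ⟶ Z} (sq : IsPullback g p' p f) :
    ∃ i' : X ⟶ Y', i' ≫ g = i ∧ E.IsConflation i' p' := by
  have := h.mono
  obtain ⟨Y₂, g₂, p₂, sq₂, K, k, w, hk⟩ := E.deflation_pullback p f h.isDeflation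
  -- The axiom only provides some pullback square; its conflation is transported to the given one.
  let e := sq₂.isoIsPullback _ _ sq
  have hk' : E.IsConflation (k ≫ e.hom) p' :=
    IsConflation.of_iso (E := E) (i := k) (p := p₂) ⟨w, hk⟩ (Iso.refl _) e (Iso.refl _)
      (by simp) (by simp [e])
  have hi' : sq.lift i 0 (by simp [h.comp_eq_zero]) ≫ g = i := sq.lift_fst _ _ _
  have : Mono (sq.lift i 0 (by simp [h.comp_eq_zero])) := by
    have : Mono (sq.lift i 0 (by simp [h.comp_eq_zero]) ≫ g) := by rwa [hi']
    exact mono_of_mono _ g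
  refine ⟨_, hi', hk'.of_kernel _ (sq.lift_snd _ _ _) fun {T} t ht => ?_⟩
  obtain ⟨l, hl⟩ := h.exists_lift (t ≫ g) (by rw [Category.assoc, sq.w, reassoc_of% ht, zero_comp])
  refine ⟨l, sq.hom_ext ?_ ?_⟩
  · rw [Category.assoc, hi', hl]
  · rw [Category.assoc, sq.lift_snd, comp_zero, ht]

lemma exists_isPullback (h : E.IsConflation i p) {Z' : A} (f : Z' ⟶ Z) :
    ∃ (Y' : A) (g : Y' ⟶ Y) (p' : Y' ⟶ Z') (i' : X ⟶ Y'),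
      IsPullback g p' p f ∧ i' ≫ g = i ∧ E.IsConflation i' p' := by
  obtain ⟨Y', g, p', sq, -⟩ := E.deflation_pullback p f h.isDeflation
  obtain ⟨i', h₁, h₂⟩ := h.of_isPullback sq
  exact ⟨Y', g, p', i', sq, h₁, h₂⟩

/-- The kernel of a composition of deflations is the base change of the first one along the
kernel of the second one. -/
lemma comp_of_isPullback (h : E.IsConflation i p) {K T : A} {j : K ⟶ T} {q : T ⟶ Y}
    (hq : E.IsConflation j q) {Q : A} {g : Q ⟶ T} {q' : Q ⟶ X} (sq : IsPullback g q' q i) :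
    E.IsConflation g (q ≫ p) := by
  have := h.mono
  have : Mono g := ⟨fun a b hab => sq.hom_ext hab (by
    rw [← cancel_mono i, Category.assoc, Category.assoc, ← sq.w, reassoc_of% hab])⟩
  obtain ⟨L, l, w, hl⟩ := E.deflation_comp q p hq.isDeflation h.isDeflation
  refine IsConflation.of_kernel (E := E) (i := l) ⟨w, hl⟩ g
    (by rw [reassoc_of% sq.w, h.comp_eq_zero, comp_zero]) fun f hf => ?_
  obtain ⟨m, hm⟩ := h.exists_lift (f ≫ q) (by rw [Category.assoc, hf])
  exact ⟨sq.lift f m hm.symm, sq.lift_fst _ _ _⟩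

lemma exists_retraction (h : E.IsConflation i p) {s : Z ⟶ Y} (hs : s ≫ p = 𝟙 Z) :
    ∃ r : Y ⟶ X, i ≫ r = 𝟙 X ∧ s ≫ r = 0 ∧ r ≫ i + p ≫ s = 𝟙 Y := by
  have := h.mono
  obtain ⟨r, hr⟩ := h.exists_lift (𝟙 Y - p ≫ s) (by simp [hs])
  refine ⟨r, ?_, ?_, by rw [hr]; abel⟩
  · rw [← cancel_mono i, Category.assoc, hr]
    simp [reassoc_of% h.comp_eq_zero]
  · rw [← cancel_mono i, Category.assoc, hr]
    simp [reassoc_of% hs]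

lemma isIso_of_isZero_left (h : E.IsConflation i p) (hX : IsZero X) : IsIso p := by
  have := h.epi
  obtain ⟨l, hl⟩ := h.exists_desc (𝟙 Y) (hX.eq_of_src _ _)
  exact ⟨l, hl, by rw [← cancel_epi p, reassoc_of% hl, Category.comp_id]⟩

lemma isZero_right_of_isZero_middle (h : E.IsConflation i p) (hY : IsZero Y) : IsZero Z := by
  have := h.epi
  rw [IsZero.iff_id_eq_zero, ← cancel_epi p]
  exact hY.eq_of_src _ _

end IsConflation

/-! ### Vanishing of `Ext1` as splitting of conflations. -/

variable (E) in
/-- Every conflation `Y ⟶ T ⟶ X` splits. -/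
def Splits (X Y : A) : Prop :=
  ∀ ⦃T : A⦄ (i : Y ⟶ T) (p : T ⟶ X), E.IsConflation i p → ∃ s : X ⟶ T, s ≫ p = 𝟙 X

variable (E) in
lemma isConflation_zero_id (X : A) {Z : A} (hZ : IsZero Z) :
    E.IsConflation (0 : Z ⟶ X) (𝟙 X) := by
  obtain ⟨Z', i, w, h⟩ := E.deflation_id X
  have h' : E.IsConflation i (𝟙 X) := ⟨w, h⟩
  have hi : i = 0 := by simpa using w
  have := h'.mono
  have hZ' : IsZero Z' := by
    rw [IsZero.iff_id_eq_zero, ← cancel_mono i, hi]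
    simp
  exact h'.of_iso (hZ'.iso hZ) (Iso.refl _) (Iso.refl _) (hZ'.eq_of_src _ _) (by simp)

variable (E) in
-- Base change of `Y = Y ↠ 0` along the zero map gives the reference split extension with which
-- others are compared.
lemma exists_split_conflation (X Y : A) :
    ∃ (T : A) (i : Y ⟶ T) (p : T ⟶ X) (s : X ⟶ T), E.IsConflation i p ∧ s ≫ p = 𝟙 X := by
  obtain ⟨Z, p, w, h⟩ := E.inflation_id Y
  have hp : p = 0 := by simpa using w
  obtain ⟨T, g, p', i', sq, -, h'⟩ :=
    IsConflation.exists_isPullback (E := E) (p := p) ⟨w, h⟩ (0 : X ⟶ Z)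
  exact ⟨T, i', p', sq.lift 0 (𝟙 X) (by simp), h', sq.lift_snd _ _ _⟩

lemma ext1Vanishes_iff_splits {X Y : A} : E.Ext1Vanishes X Y ↔ E.Splits X Y := by
  constructor
  · intro hX T i p h
    obtain ⟨T₀, i₀, p₀, s, h₀, hs⟩ := E.exists_split_conflation X Y
    obtain ⟨e, -, he⟩ : (⟨T₀, i₀, p₀, h₀⟩ : E.Extension X Y) ≈ ⟨T, i, p, h⟩ :=
      Quotient.exact (@Subsingleton.elim _ hX _ _)
    exact ⟨s ≫ e.hom, by rw [Category.assoc, he, hs]⟩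
  · refine fun hX => ⟨fun a b => ?_⟩
    induction a, b using Quotient.inductionOn₂ with
    | h S T =>
      obtain ⟨s, hs⟩ := hX _ _ S.isConflation
      obtain ⟨t, ht⟩ := hX _ _ T.isConflation
      obtain ⟨r, hr₁, hr₂, hr₃⟩ := S.isConflation.exists_retraction hs
      obtain ⟨q, hq₁, hq₂, hq₃⟩ := T.isConflation.exists_retraction ht
      -- Both middle terms decompose as `Y ⊕ X`; the isomorphism matches the summands.
      refine Quotient.sound ⟨⟨r ≫ T.i + S.p ≫ t, q ≫ S.i + T.p ≫ s, ?_, ?_⟩, ?_, ?_⟩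
      · simp [reassoc_of% hq₁, reassoc_of% hq₂, reassoc_of% T.isConflation.comp_eq_zero,
          reassoc_of% ht, hr₃]
      · simp [reassoc_of% hr₁, reassoc_of% hr₂, reassoc_of% S.isConflation.comp_eq_zero,
          reassoc_of% hs, hq₃]
      · simp [reassoc_of% hr₁, reassoc_of% S.isConflation.comp_eq_zero]
      · simp [T.isConflation.comp_eq_zero, ht]

lemma IsProjective.splits {P : A} (hP : E.IsProjective P) (Y : A) : E.Splits P Y :=
  fun _ _ p h => hP p h.isDeflation (𝟙 P)

/-- A lift of `f` amounts to a section of the base change of `p` along `f`, whose kernel is still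
`Y`. -/
lemma Splits.exists_lift {X Y : A} (hX : E.Splits X Y) {T Z : A} {i : Y ⟶ T} {p : T ⟶ Z}
    (h : E.IsConflation i p) (f : X ⟶ Z) : ∃ g : X ⟶ T, g ≫ p = f := by
  obtain ⟨T', g, p', i', sq, -, h'⟩ := h.exists_isPullback f
  obtain ⟨s, hs⟩ := hX _ _ h'
  exact ⟨s ≫ g, by rw [Category.assoc, sq.w, reassoc_of% hs]⟩

lemma Splits.of_iso {X X' Y : A} (hX : E.Splits X Y) (e : X ≅ X') : E.Splits X' Y := by
  intro T i p h
  obtain ⟨g, hg⟩ := hX.exists_lift h e.hom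
  exact ⟨e.inv ≫ g, by simp [hg]⟩

/-- Since `D` splits as `X ⊕ P`, the identity of `D` is lifted on each summand separately. -/
lemma Splits.of_isConflation_projective {X D P Y : A} (hX : E.Splits X Y) {i : X ⟶ D}
    {p : D ⟶ P} (h : E.IsConflation i p) (hP : E.IsProjective P) : E.Splits D Y := by
  intro T j q hT
  obtain ⟨s, hs⟩ := hP p h.isDeflation (𝟙 P)
  obtain ⟨r, -, -, hr⟩ := h.exists_retraction hs
  obtain ⟨a, ha⟩ := hX.exists_lift hT i
  obtain ⟨b, hb⟩ := (hP.splits Y).exists_lift hT s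
  exact ⟨r ≫ a + p ≫ b, by simp [ha, hb, hr]⟩

/-! ### Iterated resolutions and the exchange argument. -/

variable (E) in
/-- There is an iterated resolution of `M` of length `n` by objects in `P`. -/
def ResolutionLength (P : ObjectProperty A) : ℕ → A → Prop
  | 0, M => P M
  | n + 1, M => ∃ (K X : A) (i : K ⟶ X) (p : X ⟶ M),
      E.IsConflation i p ∧ P X ∧ ResolutionLength P n K

lemma ResolutionLength.mono {P P' : ObjectProperty A} (hP : P ≤ P') :
    ∀ {n : ℕ} {M : A}, E.ResolutionLength P n M → E.ResolutionLength P' n M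
  | 0, _, h => hP _ h
  | _ + 1, _, ⟨K, X, i, p, h, hX, hK⟩ => ⟨K, X, i, p, h, hP _ hX, hK.mono hP⟩

lemma ResolutionLength.of_iso {P : ObjectProperty A} [P.IsClosedUnderIsomorphisms] :
    ∀ {n : ℕ} {M M' : A}, E.ResolutionLength P n M → (M ≅ M') → E.ResolutionLength P n M'
  | 0, _, _, h, e => P.prop_of_iso e h
  | _ + 1, _, _, ⟨K, X, i, p, h, hX, hK⟩, e =>
      ⟨K, X, i, p ≫ e.hom, h.of_iso (Iso.refl _) (Iso.refl _) e (by simp) (by simp), hX, hK⟩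

lemma ResolutionLength.mem_of_closed {P W : ObjectProperty A} (hP : P ≤ W)
    (hW : ∀ {X Y Z : A} (i : X ⟶ Y) (p : Y ⟶ Z), E.IsConflation i p → W X → W Y → W Z) :
    ∀ {n : ℕ} {M : A}, E.ResolutionLength P n M → W M
  | 0, _, h => hP _ h
  | _ + 1, _, ⟨_, _, _, _, h, hX, hK⟩ => hW _ _ h (hK.mem_of_closed hP hW) (hP _ hX)

/-- Only the first term of the resolution of `D` changes: its base change to `K` is the kernel of
the composite deflation onto `X`, hence in `P`, and the syzygy `L` is kept. -/
lemma ResolutionLength.kernel {P : ObjectProperty A}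
    (hker : ∀ {X Y Z : A} (i : X ⟶ Y) (p : Y ⟶ Z), E.IsConflation i p → P Y → P Z → P X)
    {n : ℕ} {K D X : A} {i : K ⟶ D} {p : D ⟶ X} (h : E.IsConflation i p) (hX : P X)
    (hD : E.ResolutionLength P n D) : E.ResolutionLength P n K := by
  cases n with
  | zero => exact hker i p h hD hX
  | succ n =>
    obtain ⟨L, Y, j, q, hq, hY, hL⟩ := hD
    obtain ⟨Q, g, q', j', sq, -, hq'⟩ := hq.exists_isPullback i
    exact ⟨L, Q, j', q', hq', hker _ _ (h.comp_of_isPullback hq sq) hY hX, hL⟩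

/-- Here `D` is `K ⊕ Z`, so it suffices to add `Z` to the first term of the resolution of `K`. The
sum is realised as the base change of `q` along a retraction `D ⟶ K`. -/
lemma ResolutionLength.of_isConflation_projective {P : ObjectProperty A}
    [P.IsClosedUnderIsomorphisms]
    (hext : ∀ {X D Z : A} (i : X ⟶ D) (p : D ⟶ Z), E.IsConflation i p → E.IsProjective Z →
      P X → P D)
    {n : ℕ} {K D Z : A} {i : K ⟶ D} {p : D ⟶ Z} (h : E.IsConflation i p)
    (hZ : E.IsProjective Z) (hK : E.ResolutionLength P n K) : E.ResolutionLength P n D := by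
  cases n with
  | zero => exact hext i p h hZ hK
  | succ n =>
    obtain ⟨L, X, j, q, hq, hX, hL⟩ := hK
    obtain ⟨s, hs⟩ := hZ p h.isDeflation (𝟙 Z)
    obtain ⟨r, hr, -, -⟩ := h.exists_retraction hs
    obtain ⟨Q, g, q', j', sq, -, hq'⟩ := hq.exists_isPullback r
    -- As `i ≫ r = 𝟙 K`, pulling `Q` back along `i` returns `X`; hence `X` is the kernel of `Q ↠ D ↠
    -- Z`.
    have sq' : IsPullback (sq.lift (𝟙 X) (q ≫ i) (by simp [hr])) q q' i := by
      refine IsPullback.of_right (h₁₂ := g) (h₂₂ := r) ?_ (sq.lift_snd _ _ _) sq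
      rw [sq.lift_fst, hr]
      exact IsPullback.of_horiz_isIso ⟨by simp⟩
    exact ⟨L, Q, j', q', hq', hext _ _ (h.comp_of_isPullback hq' sq') hZ hX, hL⟩

/-- Objects of a class `W` with two-out-of-three that have a resolution by objects of `P` have a
resolution of the same length by objects of `P ⊓ W`. -/
lemma ResolutionLength.inf {P W : ObjectProperty A} [P.IsClosedUnderIsomorphisms]
    (hE : E.EnoughProjectives) (hproj : ∀ X : A, E.IsProjective X → (P ⊓ W) X)
    (hext : ∀ {X D Z : A} (i : X ⟶ D) (p : D ⟶ Z), E.IsConflation i p → E.IsProjective Z →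
      P X → P D)
    (hker : ∀ {X Y Z : A} (i : X ⟶ Y) (p : Y ⟶ Z), E.IsConflation i p → P Y → P Z → P X)
    (hW : ∀ {X Y Z : A} (i : X ⟶ Y) (p : Y ⟶ Z), E.IsConflation i p → W Y → W Z → W X)
    {n : ℕ} {M : A} (hM : E.ResolutionLength P n M) (hMW : W M) :
    E.ResolutionLength (P ⊓ W) n M := by
  induction n generalizing M with
  | zero => exact ⟨hM, hMW⟩
  | succ n ih =>
    obtain ⟨K, X, i, p, h, hX, hK⟩ := hM
    obtain ⟨Z, q, hZ, L, j, w, hq⟩ := hE M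
    have hq : E.IsConflation j q := ⟨w, hq⟩
    -- The pullback `D` has both `K ↣ D ↠ Z` and `L ↣ D ↠ X`, which moves the resolution from `K` to
    -- `L`.
    obtain ⟨D, g, p', i', sq, -, hp'⟩ := h.exists_isPullback q
    obtain ⟨j', -, hj'⟩ := hq.of_isPullback sq.flip
    exact ⟨L, Z, j, q, hq, hproj Z hZ,
      ih (.kernel hker hj' hX (.of_isConflation_projective hext hp' hZ hK))
        (hW j q hq (hproj Z hZ).2 hMW)⟩

/-! ### From acyclic complexes to iterated resolutions. -/

variable (E) in
/-- A spliced sequence of conflations `Z (i + 1) ⟶ Y i ⟶ Z i` with `Z 0` isomorphic to `M`, with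
`Y i` in `P` for `i ≤ n` and `Y i` zero for `i > n`. -/
def HasSplicing (P : ObjectProperty A) (n : ℕ) (M : A) : Prop :=
  ∃ (Z Y : ℕ → A) (ι : ∀ i, Z (i + 1) ⟶ Y i) (p : ∀ i, Y i ⟶ Z i),
    (∀ i, E.IsConflation (ι i) (p i)) ∧ Nonempty (Z 0 ≅ M) ∧
    (∀ i, i ≤ n → P (Y i)) ∧ (∀ i, n < i → IsZero (Y i))

lemma exists_acyclicChain (X Z : ℕ → A) (ι : ∀ i, Z i ⟶ X i) (p : ∀ i, X (i + 1) ⟶ Z i)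
    (h₀ : IsIso (ι 0)) (h : ∀ i, E.IsConflation (ι (i + 1)) (p i)) :
    ∃ K : ChainComplex A ℕ, E.AcyclicChain K ∧ K.X = X := by
  have hd : ∀ i, (p (i + 1) ≫ ι (i + 1)) ≫ p i ≫ ι i = 0 := fun i => by
    rw [Category.assoc, reassoc_of% (h i).comp_eq_zero, zero_comp, comp_zero]
  exact ⟨ChainComplex.of X (fun i => p i ≫ ι i) hd, ⟨Z, ι, p, h₀, h, fun i =>
    (ChainComplex.of_d X (fun i => p i ≫ ι i) i).symm⟩, rfl⟩

lemma exists_acyclicCochain (X Z : ℕ → A) (p : ∀ i, X i ⟶ Z i) (ι : ∀ i, Z i ⟶ X (i + 1))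
    (h₀ : IsIso (p 0)) (h : ∀ i, E.IsConflation (ι i) (p (i + 1))) :
    ∃ K : CochainComplex A ℕ, E.AcyclicCochain K ∧ K.X = X := by
  have hd : ∀ i, (p i ≫ ι i) ≫ p (i + 1) ≫ ι (i + 1) = 0 := fun i => by
    rw [Category.assoc, reassoc_of% (h i).comp_eq_zero, zero_comp, comp_zero]
  exact ⟨CochainComplex.of X (fun i => p i ≫ ι i) hd, ⟨Z, p, ι, h₀, h, fun i =>
    (CochainComplex.of_d X (fun i => p i ≫ ι i) i).symm⟩, rfl⟩

lemma hasResolution_iff_hasSplicing {P : ObjectProperty A} {n : ℕ} {M : A} :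
    E.HasResolution P n M ↔ E.HasSplicing P n M := by
  constructor
  · rintro ⟨K, ⟨Z, ι, p, h₀, h, -⟩, ⟨e⟩, hP, h0⟩
    exact ⟨Z, fun i => K.X (i + 1), fun i => ι (i + 1), p, h, ⟨asIso (ι 0) ≪≫ e⟩, hP, h0⟩
  · rintro ⟨Z, Y, ι, p, h, e, hP, h0⟩
    -- The resolved object occupies degree `0`, which shifts the terms `Y i` to degree `i + 1`.
    obtain ⟨K, h₁, h₂⟩ := exists_acyclicChain (E := E) (fun i => Nat.casesOn i (Z 0) Y) Z
      (fun i => match i with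
        | 0 => 𝟙 (Z 0)
        | i + 1 => ι i) p (inferInstanceAs (IsIso (𝟙 (Z 0)))) h
    exact ⟨K, h₁, by rw [h₂]; exact e, by rw [h₂]; exact hP, by rw [h₂]; exact h0⟩

lemma HasSplicing.resolutionLength {P : ObjectProperty A} [P.IsClosedUnderIsomorphisms] {n : ℕ}
    {M : A} (h : E.HasSplicing P n M) : E.ResolutionLength P n M := by
  obtain ⟨Z, Y, ι, p, h, ⟨e⟩, hP, h0⟩ := h
  suffices ∀ k i, i + k = n → E.ResolutionLength P k (Z i) from (this n 0 (zero_add n)).of_iso e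
  intro k
  induction k with
  | zero =>
    rintro i rfl
    -- The zero term after degree `n` kills the next syzygy, so the last term is itself the syzygy
    -- `Z n`.
    have := (h i).isIso_of_isZero_left
      ((h (i + 1)).isZero_right_of_isZero_middle (h0 _ (Nat.lt_succ_self i)))
    exact P.prop_of_iso (asIso (p i)) (hP i le_rfl)
  | succ k ih =>
    intro i hi
    exact ⟨_, _, ι i, p i, h i, hP i (by omega), ih (i + 1) (by omega)⟩

lemma ResolutionLength.hasSplicing [HasZeroObject A] {P : ObjectProperty A} :
    ∀ {n : ℕ} {M : A}, E.ResolutionLength P n M → E.HasSplicing P n M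
  | 0, M, hM => by
    -- The sequence `M, 0, 0, …` serves both as syzygies and as terms.
    let Z : ℕ → A := fun i => Nat.casesOn i M fun _ => 0
    have hZ : ∀ i, IsZero (Z (i + 1)) := fun _ => isZero_zero A
    refine ⟨Z, Z, _, _, fun i => E.isConflation_zero_id (Z i) (hZ i),
      ⟨Iso.refl _⟩, fun i hi => ?_, fun i hi => ?_⟩
    · obtain rfl : i = 0 := by omega
      exact hM
    · obtain ⟨j, rfl⟩ := Nat.exists_eq_succ_of_ne_zero hi.ne'
      exact hZ j
  | n + 1, M, ⟨K, X, i, p, h, hX, hK⟩ => by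
    obtain ⟨Z, Y, ι, q, hq, ⟨e⟩, hP, h0⟩ := hK.hasSplicing
    refine ⟨fun i => Nat.casesOn i M Z, fun i => Nat.casesOn i X Y,
      fun j => match j with
        | 0 => e.hom ≫ i
        | j + 1 => ι j,
      fun j => match j with
        | 0 => p
        | j + 1 => q j, fun j => ?_, ⟨Iso.refl _⟩, fun j hj => ?_, fun j hj => ?_⟩
    · cases j with
      | zero => exact h.of_iso e.symm (Iso.refl _) (Iso.refl _) (by simp) (by simp)
      | succ j => exact hq j
    · cases j with
      | zero => exact hX
      | succ j => exact hP j (by omega)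
    · cases j with
      | zero => omega
      | succ j => exact h0 j (by omega)

lemma hasSplicing_iff_resolutionLength [HasZeroObject A] {P : ObjectProperty A}
    [P.IsClosedUnderIsomorphisms] {n : ℕ} {M : A} :
    E.HasSplicing P n M ↔ E.ResolutionLength P n M :=
  ⟨HasSplicing.resolutionLength, ResolutionLength.hasSplicing⟩

/-- The comparison of resolutions by `C` and by `C ⊓ W`, where `C` is a left orthogonal class
closed under kernels of deflations. -/
theorem hasSplicing_inf_iff [HasZeroObject A] (hE : E.EnoughProjectives)
    {C W Q : ObjectProperty A} [W.IsClosedUnderIsomorphisms]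
    (hC : ∀ X, C X ↔ ∀ Y, Q Y → E.Splits X Y)
    (hproj : ∀ X : A, E.IsProjective X → W X)
    (hker : ∀ {X Y Z : A} (i : X ⟶ Y) (p : Y ⟶ Z), E.IsConflation i p → C Y → C Z → C X)
    (hleft : ∀ {X Y Z : A} (i : X ⟶ Y) (p : Y ⟶ Z), E.IsConflation i p → W Y → W Z → W X)
    (hright : ∀ {X Y Z : A} (i : X ⟶ Y) (p : Y ⟶ Z), E.IsConflation i p → W X → W Y → W Z)
    (n : ℕ) (M : A) :
    E.HasSplicing (C ⊓ W) n M ↔ E.HasSplicing C n M ∧ W M := by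
  have : C.IsClosedUnderIsomorphisms :=
    ⟨fun e h => (hC _).2 fun Y hY => ((hC _).1 h Y hY).of_iso e⟩
  have : (C ⊓ W).IsClosedUnderIsomorphisms :=
    ⟨fun e h => ⟨C.prop_of_iso e h.1, W.prop_of_iso e h.2⟩⟩
  rw [hasSplicing_iff_resolutionLength, hasSplicing_iff_resolutionLength]
  refine ⟨fun h => ⟨h.mono inf_le_left, h.mem_of_closed inf_le_right hright⟩, fun h => ?_⟩
  refine h.1.inf hE (fun X hX => ⟨(hC X).2 fun Y _ => hX.splits Y, hproj X hX⟩) ?_ hker hleft h.2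
  exact fun i p h hZ hX => (hC _).2 fun Y hY =>
    ((hC _).1 hX Y hY).of_isConflation_projective h hZ

/-! ### Dimension bounds and closure of thick classes under isomorphism. -/

/-- A nonempty set of extended naturals attains its infimum, and the empty one has infimum `⊤`,
which no natural number bounds. -/
lemma projDimLE_iff {P : ObjectProperty A} {n : ℕ} {M : A} :
    E.projDimLE P n M ↔ ∃ m ≤ n, E.HasResolution P m M := by
  refine ⟨fun h => ?_, fun ⟨m, hm, h⟩ => ?_⟩
  swap
  · exact le_trans (sInf_le ⟨m, rfl, h⟩) (by exact_mod_cast hm)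
  have hne : {m : ℕ∞ | ∃ n : ℕ, m = n ∧ E.HasResolution P n M}.Nonempty := by
    by_contra hne
    rw [projDimLE, projDim, Set.not_nonempty_iff_eq_empty.1 hne, sInf_empty] at h
    exact absurd h (by simp)
  obtain ⟨m, hm, hr⟩ := csInf_mem hne
  exact ⟨m, by rw [projDimLE, projDim, hm] at h; exact_mod_cast h, hr⟩

lemma injDimLE_iff {P : ObjectProperty A} {n : ℕ} {M : A} :
    E.injDimLE P n M ↔ ∃ m ≤ n, E.HasCoresolution P m M := by
  refine ⟨fun h => ?_, fun ⟨m, hm, h⟩ => ?_⟩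
  swap
  · exact le_trans (sInf_le ⟨m, rfl, h⟩) (by exact_mod_cast hm)
  have hne : {m : ℕ∞ | ∃ n : ℕ, m = n ∧ E.HasCoresolution P n M}.Nonempty := by
    by_contra hne
    rw [injDimLE, injDim, Set.not_nonempty_iff_eq_empty.1 hne, sInf_empty] at h
    exact absurd h (by simp)
  obtain ⟨m, hm, hr⟩ := csInf_mem hne
  exact ⟨m, by rw [injDimLE, injDim, hm] at h; exact_mod_cast h, hr⟩

/-- An isomorphic copy of an object is a direct summand of it, with zero complement. -/
lemma IsThick.isClosedUnderIsomorphisms [HasZeroObject A] {W : ObjectProperty A}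
    (hW : E.IsThick W) : W.IsClosedUnderIsomorphisms := by
  refine ⟨fun {X Y} e hX => ?_⟩
  refine hW.summand (X := Y) (Y := 0)
    (BinaryBicone.mk X e.hom 0 e.inv 0 (by simp) (by simp) (by simp) (by simp)) ⟨?_⟩ hX
  exact isBinaryBilimitOfTotal _ (by simp)

/-! ### Duality. -/

section Opposite

open Opposite

variable (E)

/-- The opposite exact structure. -/
def opposite : ExactStructure Aᵒᵖ where
  conflation S := E.conflation S.unop
  isKernelCokernelPair S hS := by
    obtain ⟨⟨h₁⟩, ⟨h₂⟩⟩ := E.isKernelCokernelPair _ hS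
    exact ⟨⟨CokernelCofork.IsColimit.ofπOp _ _ h₂⟩, ⟨KernelFork.IsLimit.ofιOp _ _ h₁⟩⟩
  of_iso S T := fun ⟨e⟩ hS => E.of_iso _ _
    ⟨⟨ShortComplex.unopMap e.inv, ShortComplex.unopMap e.hom,
      congrArg ShortComplex.unopMap e.hom_inv_id, congrArg ShortComplex.unopMap e.inv_hom_id⟩⟩ hS
  inflation_id X := by
    obtain ⟨Y, i, w, h⟩ := E.deflation_id X.unop
    exact ⟨op Y, i.op, Quiver.Hom.unop_inj w, h⟩
  deflation_id X := by
    obtain ⟨Y, i, w, h⟩ := E.inflation_id X.unop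
    exact ⟨op Y, i.op, Quiver.Hom.unop_inj w, h⟩
  inflation_comp := by
    rintro X Y Z i j ⟨K, p, w, h⟩ ⟨L, q, w', h'⟩
    obtain ⟨Q, k, w'', h''⟩ := E.deflation_comp j.unop i.unop
      ⟨_, _, congrArg Quiver.Hom.unop w', h'⟩ ⟨_, _, congrArg Quiver.Hom.unop w, h⟩
    exact ⟨_, k.op, Quiver.Hom.unop_inj w'', h''⟩
  deflation_comp := by
    rintro X Y Z i j ⟨K, p, w, h⟩ ⟨L, q, w', h'⟩
    obtain ⟨Q, k, w'', h''⟩ := E.inflation_comp j.unop i.unop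
      ⟨_, _, congrArg Quiver.Hom.unop w', h'⟩ ⟨_, _, congrArg Quiver.Hom.unop w, h⟩
    exact ⟨_, k.op, Quiver.Hom.unop_inj w'', h''⟩
  inflation_pushout := by
    rintro X Y X' i f ⟨K, p, w, h⟩
    obtain ⟨Q, g, i', sq, L, q, w', h'⟩ := E.deflation_pullback i.unop f.unop
      ⟨_, _, congrArg Quiver.Hom.unop w, h⟩
    exact ⟨_, g.op, i'.op, sq.op.flip, _, q.op, Quiver.Hom.unop_inj w', h'⟩
  deflation_pullback := by
    rintro X Y X' i f ⟨K, p, w, h⟩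
    obtain ⟨Q, g, i', sq, L, q, w', h'⟩ := E.inflation_pushout i.unop f.unop
      ⟨_, _, congrArg Quiver.Hom.unop w, h⟩
    exact ⟨_, g.op, i'.op, sq.op.flip, _, q.op, Quiver.Hom.unop_inj w', h'⟩

variable {E}

lemma IsConflation.op {X Y Z : A} {i : X ⟶ Y} {p : Y ⟶ Z} (h : E.IsConflation i p) :
    E.opposite.IsConflation p.op i.op :=
  ⟨Quiver.Hom.unop_inj h.1, h.2⟩

lemma IsConflation.unop {X Y Z : Aᵒᵖ} {i : X ⟶ Y} {p : Y ⟶ Z} (h : E.opposite.IsConflation i p) :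
    E.IsConflation p.unop i.unop :=
  ⟨congrArg Quiver.Hom.unop h.1, h.2⟩

lemma IsInjective.op {I : A} (hI : E.IsInjective I) : E.opposite.IsProjective (op I) := by
  rintro Y Z p ⟨X, i, w, h⟩ f
  obtain ⟨g, hg⟩ := hI p.unop ⟨_, i.unop, congrArg Quiver.Hom.unop w, h⟩ f.unop
  exact ⟨g.op, Quiver.Hom.unop_inj hg⟩

lemma EnoughInjectives.op (h : E.EnoughInjectives) : E.opposite.EnoughProjectives := by
  intro M
  obtain ⟨I, i, hI, Z, p, w, hi⟩ := h M.unop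
  exact ⟨Opposite.op I, i.op, hI.op, _, p.op, Quiver.Hom.unop_inj w, hi⟩

/-- A section of the deflation yields a retraction of the inflation, which is a section in the
opposite category. -/
lemma splits_op_iff {X Y : A} : E.opposite.Splits (op Y) (op X) ↔ E.Splits X Y := by
  constructor
  · intro h T i p hi
    obtain ⟨s, hs⟩ := h _ _ hi.op
    obtain ⟨r, hr, -⟩ := hi.op.exists_retraction hs
    exact ⟨r.unop, Quiver.Hom.op_inj hr⟩
  · intro h T i p hi
    obtain ⟨s, hs⟩ := h _ _ hi.unop
    obtain ⟨r, hr, -⟩ := hi.unop.exists_retraction hs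
    exact ⟨r.op, Quiver.Hom.unop_inj hr⟩

lemma hasCoresolution_iff_hasSplicing_op {Q : ObjectProperty A} {n : ℕ} {M : A} :
    E.HasCoresolution Q n M ↔ E.opposite.HasSplicing Q.op n (op M) := by
  constructor
  · rintro ⟨K, ⟨Z, p, ι, h₀, h, -⟩, ⟨e⟩, hP, h0⟩
    exact ⟨fun i => op (Z i), fun i => op (K.X (i + 1)), fun i => (p (i + 1)).op,
      fun i => (ι i).op, fun i => (h i).op, ⟨(e.symm ≪≫ asIso (p 0)).op⟩, hP,
      fun i hi => (h0 i hi).op⟩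
  · rintro ⟨Z, Y, ι, p, h, ⟨e⟩, hP, h0⟩
    obtain ⟨K, h₁, h₂⟩ := exists_acyclicCochain (E := E)
      (fun i => Nat.casesOn i (Z 0).unop fun j => (Y j).unop) (fun i => (Z i).unop)
      (fun i => match i with
        | 0 => 𝟙 (Z 0).unop
        | i + 1 => (ι i).unop)
      (fun i => (p i).unop) (inferInstanceAs (IsIso (𝟙 (Z 0).unop))) fun i => (h i).unop
    exact ⟨K, h₁, by rw [h₂]; exact ⟨e.symm.unop⟩, by rw [h₂]; exact hP,
      by rw [h₂]; exact fun i hi => (h0 i hi).unop⟩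

end Opposite

/-! ### Application to hereditary Hovey triples. -/

namespace IsHereditaryHoveyTriple

variable [HasZeroObject A] {C W F : ObjectProperty A}

lemma hasResolution_inf_iff (hM : E.IsHereditaryHoveyTriple C W F) (hE : E.EnoughProjectives)
    (n : ℕ) (M : A) : E.HasResolution (C ⊓ W) n M ↔ E.HasResolution C n M ∧ W M := by
  have := hM.thick.isClosedUnderIsomorphisms
  rw [hasResolution_iff_hasSplicing, hasResolution_iff_hasSplicing]
  refine hasSplicing_inf_iff hE (Q := W ⊓ F) (fun X => ?_) (fun X hX => ?_)
    hM.hereditary_cof_trivFib.kernel_mem hM.thick.left_mem hM.thick.right_mem n M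
  · simp only [← ext1Vanishes_iff_splits]
    exact iff_of_eq (congrFun hM.cof_trivFib.leftPerp_eq X).symm
  -- Projectives are left orthogonal to everything, in particular to `F`, hence lie in `C ⊓ W`.
  · have h : E.leftPerp F X := fun Y _ => ext1Vanishes_iff_splits.2 (hX.splits Y)
    rw [hM.trivCof_fib.leftPerp_eq] at h
    exact h.2

lemma hasCoresolution_inf_iff (hM : E.IsHereditaryHoveyTriple C W F) (hE : E.EnoughInjectives)
    (n : ℕ) (M : A) : E.HasCoresolution (F ⊓ W) n M ↔ E.HasCoresolution F n M ∧ W M := by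
  have := hM.thick.isClosedUnderIsomorphisms
  rw [hasCoresolution_iff_hasSplicing_op, hasCoresolution_iff_hasSplicing_op]
  -- In the opposite category `F` is the left orthogonal of `C ⊓ W`; kernels and cokernels trade
  -- places, and so do the two closure properties of `W`.
  refine hasSplicing_inf_iff hE.op (W := W.op) (Q := (C ⊓ W).op) (fun X => ?_) (fun X hX => ?_)
    (fun i p h hY hZ => hM.hereditary_trivCof_fib.cokernel_mem _ _ h.unop hZ hY)
    (fun i p h hY hZ => hM.thick.right_mem _ _ h.unop hZ hY)
    (fun i p h hX hY => hM.thick.left_mem _ _ h.unop hY hX) n (Opposite.op M)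
  · refine (iff_of_eq (congrFun hM.trivCof_fib.rightPerp_eq X.unop)).symm.trans
      ⟨fun h Y hY => splits_op_iff.2 (ext1Vanishes_iff_splits.1 (h Y.unop hY)),
        fun h Y hY => ext1Vanishes_iff_splits.2 (splits_op_iff.1 (h (Opposite.op Y) hY))⟩
  · have h : E.rightPerp C X.unop := fun Y _ =>
      ext1Vanishes_iff_splits.2 (splits_op_iff.1 (hX.splits (Opposite.op Y)))
    rw [hM.cof_trivFib.rightPerp_eq] at h
    exact h.1

end IsHereditaryHoveyTriple

end Exact

end ExactStructure

end ExactCat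

theorem corollary3p5 {A : Type u} [Category.{v} A] [Preadditive A] [HasFiniteBiproducts A]
    (E : ExactCat.ExactStructure A) (hA : ExactCat.WeaklyIdempotentComplete A)
    (hproj : E.EnoughProjectives) (hinj : E.EnoughInjectives)
    (C W F : ObjectProperty A) (hM : E.IsHereditaryHoveyTriple C W F) (n : ℕ) :
    E.projDimLE C n ⊓ W = E.projDimLE (C ⊓ W) n ∧
      W ⊓ E.injDimLE F n = E.injDimLE (W ⊓ F) n := by
  constructor
  · ext M
    change E.projDimLE C n M ∧ W M ↔ _
    simp only [ExactCat.ExactStructure.projDimLE_iff, hM.hasResolution_inf_iff hproj]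
    tauto
  · ext M
    change W M ∧ E.injDimLE F n M ↔ _
    simp only [inf_comm W F, ExactCat.ExactStructure.injDimLE_iff,
      hM.hasCoresolution_inf_iff hinj]
    tauto
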